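/- Let $n\ge 2$, let $N$ be a nonempty compact smooth manifold without boundary of dimension $n-1$, and let $F_0:N\to\mathbb{H}^n$ be a smooth embedding into hyperbolic $n$-space (of constant curvature $-1$), with image $\Sigma_0=F_0(N)$. A smooth mean curvature flow on $[0,T)$, $0\le T\le\infty$, starting at $F_0$ is a smooth map $F:N\times[0,T)\to\mathbb{H}^n$ with $F(\cdot,0)=F_0$ such that every $F(\cdot,t)$ is an immersion and $$\partial_t F(x,t)=-H\nu ,$$ where $\nu$ is a unit normal of $F(\cdot,t)$ at $x$ and $H$ is the mean curvature with respect to $\nu$, i.e. the arithmetic mean $\frac{1}{n-1}(k_1+\dots+k_{n-1})$ of the principal curvatures (with the sign for which geodesic spheres have $H>0$ with respect to the outer normal; the vector $-H\nu$ does not depend on the choice between $\nu$ and $-\nu$). Let $T_{\max}\in[0,\infty]$ be the maximal time of smooth existence, i.e. the supremum of all $T$ for which such a flow on $[0,T)$ exists. Then $$T_{\max}\le \ln\bigl(\cosh(\operatorname{diam}(\Sigma_0))\bigr),\qquad \operatorname{diam}(\Sigma_0)=\max_{p,q\in\Sigma_0}d(p,q),$$ where $d$ is the hyperbolic distance of $\mathbb{H}^n$.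 -/

import Mathlib

open scoped Manifold ContDiff ENNReal

noncomputable section

namespace HyperbolicMCF

/-- The Lorentzian inner product `⟨x, y⟩ = -x₀ y₀ + x₁ y₁ + ⋯ + xₙ yₙ` on `ℝⁿ⁺¹`. -/
def lorentz {n : ℕ} (x y : EuclideanSpace ℝ (Fin (n + 1))) : ℝ :=
  -(x 0 * y 0) + ∑ i : Fin n, x i.succ * y i.succ

/-- Hyperbolic space `ℍⁿ` (hyperboloid model): the upper sheet of `⟨x, x⟩ = -1` in `ℝⁿ⁺¹`.
Its Riemannian metric is the restriction of `lorentz` to its tangent spaces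
`T_p ℍⁿ = {v | ⟨p, v⟩ = 0}`; its topology and smooth structure are those of a submanifold
of `ℝⁿ⁺¹`, so a map into it is smooth (an immersion, an embedding) if and only if it is so
as a map into `ℝⁿ⁺¹`. -/
def hyperbolicSpace (n : ℕ) : Set (EuclideanSpace ℝ (Fin (n + 1))) :=
  {x | lorentz x x = -1 ∧ 0 < x 0}

/-- The hyperbolic distance: `cosh d(p, q) = -⟨p, q⟩`. -/
def hypDist {n : ℕ} (p q : hyperbolicSpace n) : ℝ :=
  Real.arcosh (-lorentz (p : EuclideanSpace ℝ (Fin (n + 1))) q)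

/-- The extrinsic diameter `sup {d(p, q) | p, q ∈ S}` (a maximum when `S` is compact and
nonempty). -/
def hypDiam {n : ℕ} (S : Set (hyperbolicSpace n)) : ℝ :=
  sSup {r | ∃ p ∈ S, ∃ q ∈ S, r = hypDist p q}

variable {m : ℕ} {N : Type*} [TopologicalSpace N] [ChartedSpace (EuclideanSpace ℝ (Fin m)) N]

/-- A map from an `m`-manifold to `ℍᵐ⁺¹`, seen as a map into the ambient `ℝᵐ⁺²`. -/
def ambient (F : N → hyperbolicSpace (m + 1)) (x : N) : EuclideanSpace ℝ (Fin (m + 2)) :=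
  (F x : EuclideanSpace ℝ (Fin (m + 2)))

/-- `F : N → ℍᵐ⁺¹` is a smooth immersion. -/
structure IsSmoothImmersion (F : N → hyperbolicSpace (m + 1)) : Prop where
  smooth : ContMDiff (𝓡 m) 𝓘(ℝ, EuclideanSpace ℝ (Fin (m + 2))) ∞ (ambient F)
  injective_mfderiv : ∀ x, Function.Injective
    (mfderiv (𝓡 m) 𝓘(ℝ, EuclideanSpace ℝ (Fin (m + 2))) (ambient F) x)

/-- `F : N → ℍᵐ⁺¹` is a smooth embedding: an immersion that is a homeomorphism onto its image. -/
structure IsSmoothEmbedding (F : N → hyperbolicSpace (m + 1)) : Prop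
    extends IsSmoothImmersion F where
  isEmbedding : Topology.IsEmbedding F

/-- `ν` is a unit normal vector at `x` to the hypersurface parametrized by `F`: it is tangent
to `ℍᵐ⁺¹` at `F x`, orthogonal to the image of the differential of `F`, and of length one. -/
structure IsUnitNormal (F : N → hyperbolicSpace (m + 1)) (x : N)
    (ν : EuclideanSpace ℝ (Fin (m + 2))) : Prop where
  tangent : lorentz (ambient F x) ν = 0
  normal : ∀ v : TangentSpace (𝓡 m) x,
    lorentz (mfderiv (𝓡 m) 𝓘(ℝ, EuclideanSpace ℝ (Fin (m + 2))) (ambient F) x v) ν = 0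
  unit : lorentz ν ν = 1

/-- `F` read in the chart of `N` around `x`. -/
def localMap (F : N → hyperbolicSpace (m + 1)) (x : N) :
    EuclideanSpace ℝ (Fin m) → EuclideanSpace ℝ (Fin (m + 2)) :=
  ambient F ∘ (extChartAt (𝓡 m) x).symm

/-- The partial derivative `∂ᵢ f` at `y`. -/
def partialDeriv (i : Fin m) (f : EuclideanSpace ℝ (Fin m) → EuclideanSpace ℝ (Fin (m + 2)))
    (y : EuclideanSpace ℝ (Fin m)) : EuclideanSpace ℝ (Fin (m + 2)) :=
  fderiv ℝ f y (EuclideanSpace.single i 1)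

/-- The first fundamental form (induced metric) `gᵢⱼ = ⟨∂ᵢF, ∂ⱼF⟩` at `x`, in the chart
around `x`. -/
def firstFundamentalForm (F : N → hyperbolicSpace (m + 1)) (x : N) :
    Matrix (Fin m) (Fin m) ℝ :=
  Matrix.of fun i j =>
    lorentz (partialDeriv i (localMap F x) (extChartAt (𝓡 m) x x))
      (partialDeriv j (localMap F x) (extChartAt (𝓡 m) x x))

/-- The second fundamental form `hᵢⱼ = ⟨∇ᵢν, ∂ⱼF⟩ = -⟨∇ᵢ∂ⱼF, ν⟩ = -⟨∂ᵢ∂ⱼF, ν⟩` at `x` with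
respect to the unit normal `ν`, in the chart around `x`. The Levi-Civita connection `∇` of the
hyperboloid is the tangential part of the flat derivative of `ℝᵐ⁺²`, and `ν` is tangent to the
hyperboloid, which gives the last equality. The sign is such that geodesic spheres have positive
definite `h` with respect to the outer normal. -/
def secondFundamentalForm (F : N → hyperbolicSpace (m + 1)) (x : N)
    (ν : EuclideanSpace ℝ (Fin (m + 2))) : Matrix (Fin m) (Fin m) ℝ :=
  Matrix.of fun i j =>
    -lorentz (partialDeriv i (partialDeriv j (localMap F x)) (extChartAt (𝓡 m) x x)) ν

/-- The mean curvature with respect to `ν`: the arithmetic mean of the `m` principal curvatures,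
`H = (1 / m) gⁱʲ hᵢⱼ`. -/
def meanCurvature (F : N → hyperbolicSpace (m + 1)) (x : N)
    (ν : EuclideanSpace ℝ (Fin (m + 2))) : ℝ :=
  ((firstFundamentalForm F x)⁻¹ * secondFundamentalForm F x ν).trace / m

/-- The time interval `[0, T)`, where `T` may be infinite. -/
def timeInterval (T : ℝ≥0∞) : Set ℝ :=
  {t | 0 ≤ t ∧ ENNReal.ofReal t < T}

/-- `F : N × [0, T) → ℍᵐ⁺¹`, with `F t = F(·, t)`, is a smooth mean curvature flow starting
at `F₀`: it is smooth (up to `t = 0`), every `F t` is an immersion, and `∂ₜF = -H ν`.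
The product `H ν` does not change when `ν` is replaced by `-ν` and an immersed hypersurface has
exactly two unit normals at each point, so it does not matter which of the two is used (for
an embedded closed hypersurface one may take the outer one). -/
structure IsMeanCurvatureFlow (F₀ : N → hyperbolicSpace (m + 1)) (T : ℝ≥0∞)
    (F : ℝ → N → hyperbolicSpace (m + 1)) : Prop where
  smooth : ContMDiffOn ((𝓡 m).prod 𝓘(ℝ, ℝ)) 𝓘(ℝ, EuclideanSpace ℝ (Fin (m + 2))) ∞
    (fun z : N × ℝ => ambient (F z.2) z.1) (Set.univ ×ˢ timeInterval T)
  immersion : ∀ t ∈ timeInterval T, IsSmoothImmersion (F t)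
  evolution : ∀ t ∈ timeInterval T, ∀ x, ∃ ν, IsUnitNormal (F t) x ν ∧
    HasDerivWithinAt (fun s => ambient (F s) x) (-(meanCurvature (F t) x ν • ν))
      (timeInterval T) t
  initial : F 0 = F₀

/-- The maximal time of smooth existence of the mean curvature flow starting at `F₀`: the
supremum in `[0, ∞]` of all `T` such that there is a smooth flow on `[0, T)`. -/
def maximalTime (F₀ : N → hyperbolicSpace (m + 1)) : ℝ≥0∞ :=
  sSup {T | ∃ F, IsMeanCurvatureFlow F₀ T F}

end HyperbolicMCF

end

/-!
Fix `p` in hyperbolic space and let `u = -⟨p, F⟩ = cosh d(p, F)`. The Hessian of `u` at a spatial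
maximum `x` of the hypersurface is `u g + ⟨p, ν⟩ h`, because there `p` is a combination of `F x`
and `ν`. It is nonpositive, so taking the trace with respect to `g` gives `u + ⟨p, ν⟩ H ≤ 0`. Since
`∂ₜu = ⟨p, ν⟩ H` along the flow, the maximum principle shows that the maximum of `eᵗ u` does not
increase, and `u ≥ 1` yields `eᵗ ≤ max cosh d(p, F₀)` for as long as the flow exists.
-/

namespace HyperbolicMCF

open Filter Set Topology

section Lorentz

variable {n : ℕ} {p q v ν : EuclideanSpace ℝ (Fin (n + 1))}

/-- The Lorentzian inner product `lorentz` as a continuous bilinear form. -/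
noncomputable def lorentzForm (n : ℕ) : EuclideanSpace ℝ (Fin (n + 1)) →L[ℝ]
    EuclideanSpace ℝ (Fin (n + 1)) →L[ℝ] ℝ :=
  LinearMap.toContinuousBilinearMap
    (LinearMap.mk₂ ℝ lorentz
      (fun x x' y => by
        simp only [lorentz, PiLp.add_apply, add_mul, Finset.sum_add_distrib]; ring)
      (fun c x y => by
        simp only [lorentz, PiLp.smul_apply, smul_eq_mul, mul_assoc, ← Finset.mul_sum]; ring)
      (fun x y y' => by
        simp only [lorentz, PiLp.add_apply, mul_add, Finset.sum_add_distrib]; ring)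
      (fun c x y => by
        simp only [lorentz, PiLp.smul_apply, smul_eq_mul, mul_left_comm _ c, ← Finset.mul_sum]
        ring))

@[simp]
theorem lorentzForm_apply (x y : EuclideanSpace ℝ (Fin (n + 1))) :
    lorentzForm n x y = lorentz x y := rfl

theorem lorentz_comm (x y : EuclideanSpace ℝ (Fin (n + 1))) : lorentz x y = lorentz y x := by
  simp only [lorentz, mul_comm]

theorem lorentz_add_right (x y z : EuclideanSpace ℝ (Fin (n + 1))) :
    lorentz x (y + z) = lorentz x y + lorentz x z :=
  map_add (lorentzForm n x) y z

theorem lorentz_smul_right (a : ℝ) (x y : EuclideanSpace ℝ (Fin (n + 1))) :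
    lorentz x (a • y) = a * lorentz x y :=
  map_smul (lorentzForm n x) a y

theorem lorentz_self_add_sq (v : EuclideanSpace ℝ (Fin (n + 1))) :
    lorentz v v + v 0 ^ 2 = ∑ i : Fin n, v i.succ ^ 2 := by
  simp only [lorentz, ← pow_two]
  ring

theorem lorentz_self_add_sq_nonneg (v : EuclideanSpace ℝ (Fin (n + 1))) :
    0 ≤ lorentz v v + v 0 ^ 2 := by
  rw [lorentz_self_add_sq]
  positivity

theorem eq_zero_of_lorentz_self_eq_zero (h₀ : v 0 = 0) (h : lorentz v v = 0) : v = 0 := by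
  have hsum : ∑ i : Fin n, v i.succ ^ 2 = 0 := by rw [← lorentz_self_add_sq, h₀, h]; ring
  rw [Finset.sum_eq_zero_iff_of_nonneg fun i _ => sq_nonneg (v i.succ)] at hsum
  ext i
  cases i using Fin.cases with
  | zero => exact h₀
  | succ j => exact pow_eq_zero_iff two_ne_zero |>.1 (hsum j (Finset.mem_univ j))

theorem lorentz_add_mul_sq_le (v w : EuclideanSpace ℝ (Fin (n + 1))) :
    (lorentz v w + v 0 * w 0) ^ 2 ≤ (lorentz v v + v 0 ^ 2) * (lorentz w w + w 0 ^ 2) := by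
  have hvw : lorentz v w + v 0 * w 0 = ∑ i : Fin n, v i.succ * w i.succ := by
    simp only [lorentz]
    ring
  rw [hvw, lorentz_self_add_sq, lorentz_self_add_sq]
  exact Finset.sum_mul_sq_le_sq_mul_sq _ _ _

theorem one_le_apply_zero (hp : p ∈ hyperbolicSpace n) : 1 ≤ p 0 := by
  have hsq : 0 ≤ -1 + p 0 ^ 2 := hp.1 ▸ lorentz_self_add_sq_nonneg p
  nlinarith [hp.2]

theorem lorentz_self_pos (hp : p ∈ hyperbolicSpace n) (hpv : lorentz p v = 0) (hv : v ≠ 0) :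
    0 < lorentz v v := by
  have hcs := lorentz_add_mul_sq_le p v
  rw [hp.1, hpv] at hcs
  have hle : lorentz v v + v 0 ^ 2 ≤ p 0 ^ 2 * lorentz v v := by linarith
  have hnonneg : 0 ≤ lorentz v v :=
    nonneg_of_mul_nonneg_right ((lorentz_self_add_sq_nonneg v).trans hle) (pow_pos hp.2 2)
  refine hnonneg.lt_of_ne' fun hself => hv (eq_zero_of_lorentz_self_eq_zero ?_ hself)
  rw [hself] at hle
  exact pow_eq_zero_iff two_ne_zero |>.1 (le_antisymm (by linarith) (sq_nonneg _))

theorem one_le_neg_lorentz (hp : p ∈ hyperbolicSpace n) (hq : q ∈ hyperbolicSpace n) :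
    1 ≤ -lorentz p q := by
  have hcs := lorentz_add_mul_sq_le p q
  rw [hp.1, hq.1] at hcs
  have hpq : 0 ≤ p 0 * q 0 - 1 := by nlinarith [one_le_apply_zero hp, one_le_apply_zero hq]
  have hsq : (lorentz p q + p 0 * q 0) ^ 2 ≤ (p 0 * q 0 - 1) ^ 2 := by
    nlinarith [sq_nonneg (p 0 - q 0)]
  linarith [(abs_le.1 (abs_le_of_sq_le_sq hsq hpq)).2]

variable {E : Type*} [AddCommGroup E] [Module ℝ E] [FiniteDimensional ℝ E]
  {D : E →ₗ[ℝ] EuclideanSpace ℝ (Fin (n + 1))}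

theorem exists_eq_position_add_tangent_add_normal (hE : Module.finrank ℝ E + 1 = n)
    (hq : lorentz q q = -1) (hν : lorentz ν ν = 1) (hqν : lorentz q ν = 0)
    (hqD : ∀ c, lorentz q (D c) = 0) (hνD : ∀ c, lorentz ν (D c) = 0)
    (hD : Function.Injective D) (w : EuclideanSpace ℝ (Fin (n + 1))) :
    ∃ (a : ℝ) (c : E) (b : ℝ), w = a • q + D c + b • ν := by
  let frame : (ℝ × E) × ℝ →ₗ[ℝ] EuclideanSpace ℝ (Fin (n + 1)) :=
    ((LinearMap.toSpanSingleton ℝ _ q).coprod D).coprod (LinearMap.toSpanSingleton ℝ _ ν)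
  have hinj : Function.Injective frame := by
    rw [injective_iff_map_eq_zero]
    rintro ⟨⟨a, c⟩, b⟩ (h : a • q + D c + b • ν = 0)
    have hpair (z) : a * lorentz z q + lorentz z (D c) + b * lorentz z ν = 0 := by
      simpa only [lorentz_add_right, lorentz_smul_right, lorentzForm_apply, map_zero]
        using congrArg (lorentzForm n z) h
    have ha : a = 0 := by simpa [hq, hqD, hqν] using hpair q
    have hb : b = 0 := by simpa [lorentz_comm ν q, hqν, hνD, hν] using hpair ν
    have hc : c = 0 := (map_eq_zero_iff D hD).1 (by simpa [ha, hb] using h)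
    simp [ha, hb, hc]
  have hsurj : Function.Surjective frame :=
    (LinearMap.injective_iff_surjective_of_finrank_eq_finrank (by simp; lia)).1 hinj
  obtain ⟨⟨⟨a, c⟩, b⟩, h⟩ := hsurj w
  exact ⟨a, c, b, h.symm⟩

/-- Read `q` as a point of a hypersurface of hyperbolic space, `D` as the differential of its
parametrization there and `ν` as its normal: `hpD` says that `q` is critical for `⟨p, ·⟩`. -/
theorem eq_neg_lorentz_smul_add_lorentz_smul (hE : Module.finrank ℝ E + 1 = n)
    (hq : q ∈ hyperbolicSpace n) (hν : lorentz ν ν = 1) (hqν : lorentz q ν = 0)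
    (hqD : ∀ c, lorentz q (D c) = 0) (hνD : ∀ c, lorentz ν (D c) = 0)
    (hD : Function.Injective D) (hpD : ∀ c, lorentz p (D c) = 0) :
    p = (-lorentz p q) • q + lorentz p ν • ν := by
  obtain ⟨a, c, b, hp⟩ := exists_eq_position_add_tangent_add_normal hE hq.1 hν hqν hqD hνD hD p
  have hpair (z) : lorentz p z = a * lorentz z q + lorentz z (D c) + b * lorentz z ν := by
    rw [lorentz_comm, ← lorentz_smul_right, ← lorentz_smul_right, ← lorentz_add_right,
      ← lorentz_add_right, ← hp]
  have hDc : D c = 0 := by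
    by_contra hne
    have hpos := lorentz_self_pos hq (hqD c) hne
    have hpc := hpair (D c)
    rw [hpD, lorentz_comm (D c) q, hqD, lorentz_comm (D c) ν, hνD] at hpc
    linarith
  have ha : -lorentz p q = a := by rw [hpair, hq.1, hqD, hqν]; ring
  have hb : lorentz p ν = b := by rw [hpair, lorentz_comm ν q, hqν, hνD, hν]; ring
  rw [ha, hb]
  simpa [hDc] using hp

end Lorentz

section HyperbolicDistance

variable {n : ℕ} {S : Set (hyperbolicSpace n)} {p q : hyperbolicSpace n}

theorem cosh_hypDist (p q : hyperbolicSpace n) :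
    Real.cosh (hypDist p q) = -lorentz (p : EuclideanSpace ℝ (Fin (n + 1))) q :=
  Real.cosh_arcosh (one_le_neg_lorentz p.2 q.2)

theorem hypDist_nonneg (p q : hyperbolicSpace n) : 0 ≤ hypDist p q :=
  Real.arcosh_nonneg (one_le_neg_lorentz p.2 q.2)

theorem continuous_hypDist :
    Continuous fun z : hyperbolicSpace n × hyperbolicSpace n => hypDist z.1 z.2 := by
  refine Real.continuousOn_arcosh.comp_continuous ?_ fun z => one_le_neg_lorentz z.1.2 z.2.2
  exact ((lorentzForm n).continuous₂.comp (by fun_prop :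
    Continuous fun z : hyperbolicSpace n × hyperbolicSpace n => (z.1.1, z.2.1))).neg

theorem hypDist_le_hypDiam (hS : IsCompact S) (hp : p ∈ S) (hq : q ∈ S) :
    hypDist p q ≤ hypDiam S := by
  refine le_csSup (((hS.prod hS).image continuous_hypDist).bddAbove.mono ?_) ⟨p, hp, q, hq, rfl⟩
  rintro _ ⟨a, ha, b, hb, rfl⟩
  exact ⟨(a, b), ⟨ha, hb⟩, rfl⟩

end HyperbolicDistance

section Matrix

variable {ι : Type*} [Fintype ι]

theorem trace_mul_nonpos_of_posSemidef {A B : Matrix ι ι ℝ}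
    (hA : A.PosSemidef) (hB : ∀ v, v ⬝ᵥ B.mulVec v ≤ 0) : (A * B).trace ≤ 0 := by
  obtain ⟨k, v, rfl⟩ := Matrix.posSemidef_iff_eq_sum_vecMulVec.1 hA
  rw [Finset.sum_mul, Matrix.trace_sum]
  refine Finset.sum_nonpos fun i _ => ?_
  rw [Matrix.vecMulVec_mul, Matrix.trace_vecMulVec, star_trivial, dotProduct_comm,
    ← Matrix.dotProduct_mulVec]
  exact hB _

theorem dotProduct_mulVec_eq_of_apply_single [DecidableEq ι] {A : Matrix ι ι ℝ}
    {B : EuclideanSpace ℝ ι →L[ℝ] EuclideanSpace ℝ ι →L[ℝ] ℝ}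
    (hA : ∀ i j, A i j = B (EuclideanSpace.single i 1) (EuclideanSpace.single j 1))
    (v w : ι → ℝ) : v ⬝ᵥ A.mulVec w = B (WithLp.toLp 2 v) (WithLp.toLp 2 w) := by
  have hAB : A = LinearMap.toMatrix₂ (EuclideanSpace.basisFun ι ℝ).toBasis
      (EuclideanSpace.basisFun ι ℝ).toBasis B.toLinearMap₁₂ := by
    ext i j
    simp [hA]
  rw [hAB]
  exact dotProduct_toMatrix₂_mulVec (EuclideanSpace.basisFun ι ℝ).toBasis
    (EuclideanSpace.basisFun ι ℝ).toBasis B.toLinearMap₁₂ v w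

end Matrix

section Calculus

variable {E V : Type*} [NormedAddCommGroup E] [NormedSpace ℝ E] [NormedAddCommGroup V]
  [NormedSpace ℝ V]

theorem deriv_deriv_nonpos_of_isLocalMax {f : ℝ → ℝ} {a : ℝ} (h : IsLocalMax f a)
    (hf : ContinuousAt f a) : deriv (deriv f) a ≤ 0 := by
  by_contra! hpos
  have hmin := isLocalMin_of_deriv_deriv_pos hpos h.deriv_eq_zero hf
  have hconst : f =ᶠ[𝓝 a] fun _ => f a := by
    filter_upwards [h, hmin] with x hle hge using le_antisymm hle hge
  simp [hconst.deriv.deriv_eq] at hpos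

theorem apply_self_nonpos_of_isLocalMax {f : E → ℝ} {f' : E → E →L[ℝ] ℝ}
    {f'' : E →L[ℝ] E →L[ℝ] ℝ} {y : E} (h : IsLocalMax f y)
    (hf : ∀ᶠ z in 𝓝 y, HasFDerivAt f (f' z) z) (hf' : HasFDerivAt f' f'' y) (c : E) :
    f'' c c ≤ 0 := by
  have hline (s : ℝ) : HasDerivAt (fun s : ℝ => y + s • c) c s := by
    simpa using ((hasDerivAt_id s).smul_const c).const_add y
  have htendsto : Tendsto (fun s : ℝ => y + s • c) (𝓝 0) (𝓝 y) := by
    simpa using (hline 0).continuousAt.tendsto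
  have hmax : IsLocalMax (fun s : ℝ => f (y + s • c)) 0 := by
    simpa [IsLocalMax, IsMaxFilter] using htendsto.eventually h
  have hderiv : ∀ᶠ s in 𝓝 (0 : ℝ),
      HasDerivAt (fun s : ℝ => f (y + s • c)) (f' (y + s • c) c) s :=
    (htendsto.eventually hf).mono fun s hs => hs.comp_hasDerivAt s (hline s)
  have hderiv₂ : HasDerivAt (fun s : ℝ => f' (y + s • c) c) (f'' c c) 0 := by
    have hcomp := HasFDerivAt.comp_hasDerivAt_of_eq (0 : ℝ) hf' (hline 0) (by simp)
    simpa using hcomp.clm_apply (hasDerivAt_const (0 : ℝ) c)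
  have hle := deriv_deriv_nonpos_of_isLocalMax hmax hderiv.self_of_nhds.continuousAt
  have hderiv_eq : deriv (fun s : ℝ => f (y + s • c)) =ᶠ[𝓝 0] fun s => f' (y + s • c) c :=
    hderiv.mono fun s hs => hs.deriv
  rwa [hderiv_eq.deriv_eq, hderiv₂.deriv] at hle

theorem eventually_hasFDerivAt {G : E → V} {y : E} (hG : ContDiffAt ℝ 2 G y) :
    ∀ᶠ z in 𝓝 y, HasFDerivAt G (fderiv ℝ G z) z :=
  (hG.eventually (by simp)).mono fun _ hz => (hz.differentiableAt (by simp)).hasFDerivAt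

theorem hasFDerivAt_fderiv {G : E → V} {y : E} (hG : ContDiffAt ℝ 2 G y) :
    HasFDerivAt (fderiv ℝ G) (fderiv ℝ (fderiv ℝ G) y) y :=
  ((hG.fderiv_right (m := 1) (by norm_num)).differentiableAt (by simp)).hasFDerivAt

theorem apply_fderiv_fderiv_self_nonpos_of_isLocalMax {G : E → V} {y : E}
    (hG : ContDiffAt ℝ 2 G y) (L : V →L[ℝ] ℝ) (h : IsLocalMax (fun z => L (G z)) y) (c : E) :
    L (fderiv ℝ (fderiv ℝ G) y c c) ≤ 0 :=
  apply_self_nonpos_of_isLocalMax (f' := fun z => L ∘L fderiv ℝ G z)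
    (f'' := ContinuousLinearMap.compL ℝ E V ℝ L ∘L fderiv ℝ (fderiv ℝ G) y) h
    ((eventually_hasFDerivAt hG).mono fun z hz => L.hasFDerivAt.comp z hz)
    ((ContinuousLinearMap.compL ℝ E V ℝ L).hasFDerivAt.comp y (hasFDerivAt_fderiv hG)) c

theorem deriv_nonneg_of_isMaxOn_Icc {f : ℝ → ℝ} {f' a b t : ℝ} (ht : t ∈ Ioc a b)
    (hf : HasDerivWithinAt f f' (Icc a b) t) (hmax : IsMaxOn f (Icc a b) t) : 0 ≤ f' := by
  have hseg : segment ℝ t a ⊆ Icc a b :=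
    (convex_Icc a b).segment_subset ⟨ht.1.le, ht.2⟩ ⟨le_rfl, ht.1.le.trans ht.2⟩
  have hle : (a - t) * f' ≤ 0 := by
    simpa using hmax.localize.hasFDerivWithinAt_nonpos hf.hasFDerivWithinAt
      (sub_mem_posTangentConeAt_of_segment_subset hseg)
  exact nonneg_of_mul_nonpos_right hle (sub_neg.2 ht.1)

end Calculus

section MaximumPrinciple

variable {X : Type*} [TopologicalSpace X] [CompactSpace X] {u : X → ℝ → ℝ} {a b M : ℝ}

theorem le_of_hasDerivWithinAt_neg_of_forall_le
    (hu : ContinuousOn (fun z : X × ℝ => u z.1 z.2) (univ ×ˢ Icc a b)) (ha : ∀ x, u x a ≤ M)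
    (hderiv : ∀ t ∈ Ioc a b, ∀ x, (∀ z, u z t ≤ u x t) →
      ∃ u' < 0, HasDerivWithinAt (u x) u' (Icc a b) t)
    {t : ℝ} (ht : t ∈ Icc a b) (x : X) : u x t ≤ M := by
  obtain ⟨⟨x₁, t₁⟩, ⟨-, ht₁⟩, hmax⟩ :=
    (isCompact_univ.prod isCompact_Icc).exists_isMaxOn ⟨(x, t), mem_univ x, ht⟩ hu
  have hle (z : X) (s : ℝ) (hs : s ∈ Icc a b) : u z s ≤ u x₁ t₁ :=
    hmax (show (z, s) ∈ univ ×ˢ Icc a b from ⟨mem_univ z, hs⟩)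
  obtain hat | rfl := ht₁.1.lt_or_eq
  · obtain ⟨u', hneg, hu'⟩ := hderiv t₁ ⟨hat, ht₁.2⟩ x₁ fun z => hle z t₁ ht₁
    exact absurd (deriv_nonneg_of_isMaxOn_Icc ⟨hat, ht₁.2⟩ hu' (hle x₁)) hneg.not_ge
  · exact (hle x t ht).trans (ha x₁)

theorem le_of_hasDerivWithinAt_nonpos_of_forall_le
    (hu : ContinuousOn (fun z : X × ℝ => u z.1 z.2) (univ ×ˢ Icc a b)) (ha : ∀ x, u x a ≤ M)
    (hderiv : ∀ t ∈ Ioc a b, ∀ x, (∀ z, u z t ≤ u x t) →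
      ∃ u' ≤ 0, HasDerivWithinAt (u x) u' (Icc a b) t)
    {t : ℝ} (ht : t ∈ Icc a b) (x : X) : u x t ≤ M := by
  have hperturbed (ε : ℝ) (hε : 0 < ε) : u x t - ε * (t - a) ≤ M := by
    refine le_of_hasDerivWithinAt_neg_of_forall_le (u := fun x t => u x t - ε * (t - a))
      (hu.sub (by fun_prop)) (by simpa using ha) (fun s hs z hz => ?_) ht x
    obtain ⟨u', hu'₀, hu'⟩ := hderiv s hs z (by simpa using hz)
    exact ⟨u' - ε * 1, by linarith,
      hu'.sub (((hasDerivWithinAt_id s _).sub_const a).const_mul ε)⟩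
  have hlim : Tendsto (fun ε : ℝ => u x t - ε * (t - a)) (𝓝[>] 0) (𝓝 (u x t)) := by
    have : Continuous fun ε : ℝ => u x t - ε * (t - a) := by fun_prop
    simpa using (this.tendsto 0).mono_left nhdsWithin_le_nhds
  exact le_of_tendsto hlim (eventually_mem_nhdsWithin.mono hperturbed)

end MaximumPrinciple

section MapsToHyperbolicSpace

variable {E : Type*} [NormedAddCommGroup E] [NormedSpace ℝ E] {n : ℕ}
  {G : E → EuclideanSpace ℝ (Fin (n + 1))} {y : E}

theorem lorentz_fderiv_eq_zero (hG : DifferentiableAt ℝ G y)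
    (hmem : ∀ z, G z ∈ hyperbolicSpace n) (c : E) : lorentz (G y) (fderiv ℝ G y c) = 0 := by
  have hconst : (fun z => lorentzForm n (G z) (G z)) = fun _ => -1 := funext fun z => (hmem z).1
  have hprod := (lorentzForm n).hasFDerivAt_of_bilinear hG.hasFDerivAt hG.hasFDerivAt
  rw [hconst] at hprod
  have hsum : lorentz (G y) (fderiv ℝ G y c) + lorentz (fderiv ℝ G y c) (G y) = 0 := by
    simpa using DFunLike.congr_fun (hprod.unique (hasFDerivAt_const (-1) y)) c
  rw [lorentz_comm (fderiv ℝ G y c)] at hsum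
  linarith

theorem lorentz_fderiv_fderiv (hG : ContDiffAt ℝ 2 G y) (hmem : ∀ z, G z ∈ hyperbolicSpace n)
    (c c' : E) : lorentz (G y) (fderiv ℝ (fderiv ℝ G) y c c') =
      -lorentz (fderiv ℝ G y c) (fderiv ℝ G y c') := by
  have hzero : (fun z => lorentzForm n (G z) (fderiv ℝ G z c')) =ᶠ[𝓝 y] fun _ => 0 :=
    (eventually_hasFDerivAt hG).mono fun z hz =>
      lorentz_fderiv_eq_zero hz.differentiableAt hmem c'
  have hprod := (lorentzForm n).hasFDerivAt_of_bilinear (eventually_hasFDerivAt hG).self_of_nhds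
    ((hasFDerivAt_fderiv hG).clm_apply (hasFDerivAt_const c' y))
  have hsum : lorentz (G y) (fderiv ℝ (fderiv ℝ G) y c c') +
      lorentz (fderiv ℝ G y c) (fderiv ℝ G y c') = 0 := by
    simpa using DFunLike.congr_fun
      (hprod.unique ((hasFDerivAt_const 0 y).congr_of_eventuallyEq hzero)) c
  linarith

end MapsToHyperbolicSpace

section Hypersurface

variable {m : ℕ} {N : Type*} [TopologicalSpace N] [ChartedSpace (EuclideanSpace ℝ (Fin m)) N]
  {F : N → hyperbolicSpace (m + 1)} {x : N} {p ν : EuclideanSpace ℝ (Fin (m + 2))}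

/-- The differential of `F` at `x` in the chart around `x`. -/
noncomputable def chartDeriv (F : N → hyperbolicSpace (m + 1)) (x : N) :
    EuclideanSpace ℝ (Fin m) →L[ℝ] EuclideanSpace ℝ (Fin (m + 2)) :=
  fderiv ℝ (localMap F x) (extChartAt (𝓡 m) x x)

/-- The second derivative of `F` at `x` in the chart around `x`, as a map into the ambient linear
space: `chartSecondDeriv F x eᵢ eⱼ = ∂ᵢ∂ⱼF`. -/
noncomputable def chartSecondDeriv (F : N → hyperbolicSpace (m + 1)) (x : N) :
    EuclideanSpace ℝ (Fin m) →L[ℝ] EuclideanSpace ℝ (Fin m) →L[ℝ]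
      EuclideanSpace ℝ (Fin (m + 2)) :=
  fderiv ℝ (fderiv ℝ (localMap F x)) (extChartAt (𝓡 m) x x)

theorem localMap_extChartAt_self (F : N → hyperbolicSpace (m + 1)) (x : N) :
    localMap F x (extChartAt (𝓡 m) x x) = ambient F x := by
  simp [localMap]

theorem contDiffAt_localMap (hF : IsSmoothImmersion F) (x : N) :
    ContDiffAt ℝ 2 (localMap F x) (extChartAt (𝓡 m) x x) := by
  have h : ContDiffWithinAt ℝ ∞ (localMap F x) (range (𝓡 m)) (extChartAt (𝓡 m) x x) :=
    (contMDiffAt_iff.1 (hF.smooth x)).2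
  rw [ModelWithCorners.range_eq_univ, contDiffWithinAt_univ] at h
  exact h.of_le (by norm_cast)

theorem mfderiv_ambient (hF : IsSmoothImmersion F) (x : N) :
    mfderiv (𝓡 m) 𝓘(ℝ, EuclideanSpace ℝ (Fin (m + 2))) (ambient F) x = chartDeriv F x := by
  rw [((hF.smooth x).mdifferentiableAt (by simp)).mfderiv]
  change fderivWithin ℝ (localMap F x) (range (𝓡 m)) (extChartAt (𝓡 m) x x) = _
  rw [ModelWithCorners.range_eq_univ, fderivWithin_univ, chartDeriv]

theorem chartDeriv_injective (hF : IsSmoothImmersion F) (x : N) :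
    Function.Injective (chartDeriv F x) :=
  mfderiv_ambient hF x ▸ hF.injective_mfderiv x

theorem lorentz_chartDeriv (hF : IsSmoothImmersion F) (x : N) (c : EuclideanSpace ℝ (Fin m)) :
    lorentz (ambient F x) (chartDeriv F x c) = 0 := by
  rw [← localMap_extChartAt_self]
  exact lorentz_fderiv_eq_zero ((contDiffAt_localMap hF x).differentiableAt (by simp))
    (fun z => (F _).2) c

theorem lorentz_chartSecondDeriv (hF : IsSmoothImmersion F) (x : N)
    (c c' : EuclideanSpace ℝ (Fin m)) :
    lorentz (ambient F x) (chartSecondDeriv F x c c') =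
      -lorentz (chartDeriv F x c) (chartDeriv F x c') := by
  rw [← localMap_extChartAt_self]
  exact lorentz_fderiv_fderiv (contDiffAt_localMap hF x) (fun z => (F _).2) c c'

theorem IsUnitNormal.lorentz_chartDeriv (hν : IsUnitNormal F x ν) (hF : IsSmoothImmersion F)
    (c : EuclideanSpace ℝ (Fin m)) : lorentz ν (chartDeriv F x c) = 0 := by
  rw [lorentz_comm, ← mfderiv_ambient hF]
  exact hν.normal c

theorem partialDeriv_partialDeriv_localMap (hF : IsSmoothImmersion F) (x : N) (i j : Fin m) :
    partialDeriv i (partialDeriv j (localMap F x)) (extChartAt (𝓡 m) x x) =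
      chartSecondDeriv F x (EuclideanSpace.single i 1) (EuclideanSpace.single j 1) := by
  have h : HasFDerivAt (partialDeriv j (localMap F x)) _ (extChartAt (𝓡 m) x x) :=
    (hasFDerivAt_fderiv (contDiffAt_localMap hF x)).clm_apply
      (hasFDerivAt_const (EuclideanSpace.single j (1 : ℝ)) _)
  rw [partialDeriv, h.fderiv]
  simp [chartSecondDeriv]

theorem dotProduct_firstFundamentalForm_mulVec (F : N → hyperbolicSpace (m + 1)) (x : N)
    (v w : Fin m → ℝ) : v ⬝ᵥ (firstFundamentalForm F x).mulVec w =
      lorentz (chartDeriv F x (WithLp.toLp 2 v)) (chartDeriv F x (WithLp.toLp 2 w)) :=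
  dotProduct_mulVec_eq_of_apply_single
    (B := (lorentzForm (m + 1)).bilinearComp (chartDeriv F x) (chartDeriv F x))
    (fun _ _ => rfl) v w

theorem dotProduct_secondFundamentalForm_mulVec (hF : IsSmoothImmersion F) (x : N)
    (ν : EuclideanSpace ℝ (Fin (m + 2))) (v w : Fin m → ℝ) :
    v ⬝ᵥ (secondFundamentalForm F x ν).mulVec w =
      -lorentz ν (chartSecondDeriv F x (WithLp.toLp 2 v) (WithLp.toLp 2 w)) :=
  dotProduct_mulVec_eq_of_apply_single
    (B := ContinuousLinearMap.compL ℝ _ _ ℝ (-lorentzForm (m + 1) ν) ∘L chartSecondDeriv F x)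
    (fun i j => by
      rw [secondFundamentalForm, Matrix.of_apply, partialDeriv_partialDeriv_localMap hF,
        lorentz_comm]
      rfl) v w

theorem posDef_firstFundamentalForm (hF : IsSmoothImmersion F) (x : N) :
    (firstFundamentalForm F x).PosDef := by
  refine Matrix.PosDef.of_dotProduct_mulVec_pos ?_ fun v hv => ?_
  · ext i j
    simp [firstFundamentalForm, lorentz_comm]
  · rw [star_trivial, dotProduct_firstFundamentalForm_mulVec]
    refine lorentz_self_pos (F x).2 (lorentz_chartDeriv hF x _) ?_
    rw [Ne, map_eq_zero_iff _ (chartDeriv_injective hF x)]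
    simpa using hv

theorem isLocalMax_localMap (h : IsLocalMax (fun z => -lorentz p (ambient F z)) x) :
    IsLocalMax (fun z => (-lorentzForm (m + 1) p) (localMap F x z)) (extChartAt (𝓡 m) x x) := by
  have htendsto : Tendsto (extChartAt (𝓡 m) x).symm (𝓝 (extChartAt (𝓡 m) x x)) (𝓝 x) := by
    simpa using (continuousAt_extChartAt_symm (I := 𝓡 m) x).tendsto
  simpa [IsLocalMax, IsMaxFilter, localMap] using htendsto.eventually h

theorem lorentz_chartDeriv_eq_zero_of_isLocalMax (hF : IsSmoothImmersion F)
    (h : IsLocalMax (fun z => -lorentz p (ambient F z)) x) (c : EuclideanSpace ℝ (Fin m)) :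
    lorentz p (chartDeriv F x c) = 0 := by
  have hcrit := (isLocalMax_localMap h).hasFDerivAt_eq_zero
    ((-lorentzForm (m + 1) p).hasFDerivAt.comp _
      (eventually_hasFDerivAt (contDiffAt_localMap hF x)).self_of_nhds)
  exact neg_eq_zero.1 (DFunLike.congr_fun hcrit c)

theorem lorentz_chartSecondDeriv_nonneg_of_isLocalMax (hF : IsSmoothImmersion F)
    (h : IsLocalMax (fun z => -lorentz p (ambient F z)) x) (c : EuclideanSpace ℝ (Fin m)) :
    0 ≤ lorentz p (chartSecondDeriv F x c c) := by
  exact neg_nonpos.1 (apply_fderiv_fderiv_self_nonpos_of_isLocalMax (contDiffAt_localMap hF x)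
    (-lorentzForm (m + 1) p) (isLocalMax_localMap h) c)

theorem dotProduct_smul_add_smul_mulVec_nonpos_of_isLocalMax (hF : IsSmoothImmersion F)
    (hν : IsUnitNormal F x ν) (h : IsLocalMax (fun z => -lorentz p (ambient F z)) x)
    (v : Fin m → ℝ) :
    v ⬝ᵥ ((-lorentz p (ambient F x)) • firstFundamentalForm F x +
      lorentz p ν • secondFundamentalForm F x ν).mulVec v ≤ 0 := by
  have hp : p = (-lorentz p (ambient F x)) • ambient F x + lorentz p ν • ν :=
    eq_neg_lorentz_smul_add_lorentz_smul (D := (chartDeriv F x).toLinearMap) (by simp) (F x).2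
      hν.unit hν.tangent (lorentz_chartDeriv hF x) (hν.lorentz_chartDeriv hF)
      (chartDeriv_injective hF x) (lorentz_chartDeriv_eq_zero_of_isLocalMax hF h)
  have hpair (w) : lorentz p w =
      (-lorentz p (ambient F x)) * lorentz (ambient F x) w + lorentz p ν * lorentz ν w := by
    conv_lhs => rw [hp]
    rw [lorentz_comm, lorentz_add_right, lorentz_smul_right, lorentz_smul_right, lorentz_comm w,
      lorentz_comm w]
  have hnonneg := lorentz_chartSecondDeriv_nonneg_of_isLocalMax hF h (WithLp.toLp 2 v)
  rw [hpair, lorentz_chartSecondDeriv hF] at hnonneg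
  simp only [Matrix.add_mulVec, Matrix.smul_mulVec, dotProduct_add, dotProduct_smul, smul_eq_mul,
    dotProduct_firstFundamentalForm_mulVec, dotProduct_secondFundamentalForm_mulVec hF]
  linarith

theorem neg_lorentz_add_mul_meanCurvature_nonpos (hm : 1 ≤ m) (hF : IsSmoothImmersion F)
    (hν : IsUnitNormal F x ν) (h : IsLocalMax (fun z => -lorentz p (ambient F z)) x) :
    -lorentz p (ambient F x) + lorentz p ν * meanCurvature F x ν ≤ 0 := by
  have hg := posDef_firstFundamentalForm hF x
  have htrace := trace_mul_nonpos_of_posSemidef hg.posSemidef.inv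
    (dotProduct_smul_add_smul_mulVec_nonpos_of_isLocalMax hF hν h)
  rw [mul_add, mul_smul_comm, mul_smul_comm,
    Matrix.nonsing_inv_mul _ ((Matrix.isUnit_iff_isUnit_det _).1 hg.isUnit), Matrix.trace_add,
    Matrix.trace_smul, Matrix.trace_smul, Matrix.trace_one, Fintype.card_fin, smul_eq_mul,
    smul_eq_mul] at htrace
  have hm₀ : (0 : ℝ) < m := by exact_mod_cast hm
  refine nonpos_of_mul_nonpos_left ?_ hm₀
  rwa [add_mul, mul_assoc _ _ (m : ℝ), meanCurvature, div_mul_cancel₀ _ hm₀.ne']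

end Hypersurface

section Flow

variable {m : ℕ} {N : Type*} [TopologicalSpace N] [ChartedSpace (EuclideanSpace ℝ (Fin m)) N]
  {F₀ : N → hyperbolicSpace (m + 1)} {T : ℝ≥0∞} {F : ℝ → N → hyperbolicSpace (m + 1)}

theorem Icc_subset_timeInterval {t : ℝ} (ht : t ∈ timeInterval T) : Icc 0 t ⊆ timeInterval T :=
  fun _ hs => ⟨hs.1, (ENNReal.ofReal_le_ofReal hs.2).trans_lt ht.2⟩

theorem le_ofReal_of_forall_mem_timeInterval {c : ℝ} (h : ∀ t ∈ timeInterval T, t ≤ c) :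
    T ≤ ENNReal.ofReal c := by
  refine ENNReal.le_of_forall_nnreal_lt fun r hr => ?_
  rw [← ENNReal.ofReal_coe_nnreal] at hr ⊢
  exact ENNReal.ofReal_le_ofReal (h r ⟨r.2, hr⟩)

theorem IsMeanCurvatureFlow.hasDerivWithinAt_exp_mul_neg_lorentz
    (hF : IsMeanCurvatureFlow F₀ T F) (p : EuclideanSpace ℝ (Fin (m + 2))) {t : ℝ}
    (ht : t ∈ timeInterval T) (x : N) :
    ∃ ν, IsUnitNormal (F t) x ν ∧
      HasDerivWithinAt (fun s => Real.exp s * -lorentz p (ambient (F s) x))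
        (Real.exp t * (-lorentz p (ambient (F t) x) + lorentz p ν * meanCurvature (F t) x ν))
        (timeInterval T) t := by
  obtain ⟨ν, hν, hderiv⟩ := hF.evolution t ht x
  refine ⟨ν, hν, ?_⟩
  have hheight := ((-lorentzForm (m + 1) p).hasFDerivAt.comp_hasDerivWithinAt t hderiv)
  refine ((Real.hasDerivAt_exp t).hasDerivWithinAt.mul hheight).congr_deriv ?_
  simp only [neg_apply, lorentzForm_apply, Function.comp_apply, ← neg_smul,
    lorentz_smul_right]
  ring

theorem IsMeanCurvatureFlow.exp_mul_neg_lorentz_le [CompactSpace N] (hm : 1 ≤ m)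
    (hF : IsMeanCurvatureFlow F₀ T F) {p : EuclideanSpace ℝ (Fin (m + 2))} {M : ℝ}
    (hM : ∀ x, -lorentz p (ambient F₀ x) ≤ M) {t : ℝ} (ht : t ∈ timeInterval T) (x : N) :
    Real.exp t * -lorentz p (ambient (F t) x) ≤ M := by
  have hsub := Icc_subset_timeInterval ht
  have hcont : ContinuousOn (fun z : N × ℝ => Real.exp z.2 * -lorentz p (ambient (F z.2) z.1))
      (univ ×ˢ Icc 0 t) :=
    (Real.continuous_exp.comp continuous_snd).continuousOn.mul
      ((lorentzForm (m + 1) p).continuous.comp_continuousOn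
        (hF.smooth.continuousOn.mono (prod_mono_right hsub))).neg
  refine le_of_hasDerivWithinAt_nonpos_of_forall_le
    (u := fun x t => Real.exp t * -lorentz p (ambient (F t) x)) hcont
    (by simpa [hF.initial] using hM) (fun s hs z hmax => ?_) ⟨ht.1, le_rfl⟩ x
  have hs' : s ∈ timeInterval T := hsub (Ioc_subset_Icc_self hs)
  obtain ⟨ν, hν, hderiv⟩ := hF.hasDerivWithinAt_exp_mul_neg_lorentz p hs' z
  have hlocal : IsLocalMax (fun z => -lorentz p (ambient (F s) z)) z :=
    Eventually.of_forall fun y => le_of_mul_le_mul_left (hmax y) (Real.exp_pos s)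
  exact ⟨_, mul_nonpos_of_nonneg_of_nonpos (Real.exp_pos s).le
    (neg_lorentz_add_mul_meanCurvature_nonpos hm (hF.immersion s hs') hν hlocal),
    hderiv.mono hsub⟩

theorem IsMeanCurvatureFlow.le_log_cosh [CompactSpace N] [Nonempty N] (hm : 1 ≤ m)
    (hF : IsMeanCurvatureFlow F₀ T F) {p : hyperbolicSpace (m + 1)} {R : ℝ}
    (hR : ∀ x, hypDist p (F₀ x) ≤ R) : T ≤ ENNReal.ofReal (Real.log (Real.cosh R)) := by
  refine le_ofReal_of_forall_mem_timeInterval fun t ht => ?_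
  obtain ⟨x⟩ := ‹Nonempty N›
  have hinitial (z : N) : -lorentz p.1 (ambient F₀ z) ≤ Real.cosh R := by
    rw [ambient, ← cosh_hypDist]
    exact Real.cosh_le_cosh.2 (abs_le_abs_of_nonneg (hypDist_nonneg _ _) (hR z))
  rw [Real.le_log_iff_exp_le (Real.cosh_pos R)]
  calc Real.exp t ≤ Real.exp t * -lorentz p.1 (ambient (F t) x) :=
        le_mul_of_one_le_right (Real.exp_pos t).le (one_le_neg_lorentz p.2 (F t x).2)
    _ ≤ Real.cosh R := hF.exp_mul_neg_lorentz_le hm hinitial ht x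

end Flow

end HyperbolicMCF

theorem corollary3p5_general (m : ℕ) (hm : 1 ≤ m) (N : Type*) [TopologicalSpace N]
    [CompactSpace N] [Nonempty N] [ChartedSpace (EuclideanSpace ℝ (Fin m)) N]
    (F₀ : N → HyperbolicMCF.hyperbolicSpace (m + 1)) (p : HyperbolicMCF.hyperbolicSpace (m + 1))
    (R : ℝ) (hR : ∀ x, HyperbolicMCF.hypDist p (F₀ x) ≤ R) :
    HyperbolicMCF.maximalTime F₀ ≤ ENNReal.ofReal (Real.log (Real.cosh R)) :=
  sSup_le fun _ ⟨_, hF⟩ => hF.le_log_cosh hm hR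

theorem corollary3p5 (m : ℕ) (hm : 1 ≤ m) (N : Type*) [TopologicalSpace N] [T2Space N]
    [CompactSpace N] [Nonempty N] [ChartedSpace (EuclideanSpace ℝ (Fin m)) N]
    [IsManifold (𝓡 m) ∞ N] (F₀ : N → HyperbolicMCF.hyperbolicSpace (m + 1))
    (hF₀ : HyperbolicMCF.IsSmoothEmbedding F₀) :
    HyperbolicMCF.maximalTime F₀ ≤
      ENNReal.ofReal (Real.log (Real.cosh (HyperbolicMCF.hypDiam (Set.range F₀)))) := by
  obtain ⟨x⟩ := ‹Nonempty N›
  exact corollary3p5_general m hm N F₀ (F₀ x) _ fun y => HyperbolicMCF.hypDist_le_hypDiam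
    (isCompact_range hF₀.isEmbedding.continuous) (Set.mem_range_self x) (Set.mem_range_self y)
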